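/- Let $\mathcal H(k)$ be the group of link-homotopy classes of ordered, oriented string links with $k$ components, in its standard description: the quotient of the pure braid group $P(k)$, generated by the standard pure braids $\tau_{ij}=\tau_{ji}$ ($1\le i<j\le k$) subject to Artin's relations, by the normal subgroup generated by all commutators $[\tau_{ij},g\tau_{ij}g^{-1}]$, $g\in P(k)$. Here $[a,b]=aba^{-1}b^{-1}$, and $G_1=G$, $G_{n+1}=[G_n,G]$ is the lower central series of a group $G$. For a set $S$ of components, deleting the components outside $S$ is the homomorphism to the group $\mathcal H(S)$ of string links with components indexed by $S$ that sends $\tau_{ij}$ to $\tau_{ij}$ if $i,j\in S$ and to $1$ otherwise; it is split by the homomorphism $\tau_{ij}\mapsto\tau_{ij}$. Let $d_i:\mathcal H(k)\to\mathcal H(k-1)$ be the deletion of the $i$-th component alone. For $\sigma\in\mathcal H(k)$ let $l_{ij}=l_{ji}$ be the linking numbers of $\sigma$ (the exponent sum of $\tau_{ij}$ in $\sigma$), with $l_{ii}=0$. For $i\ne j$, the conjugation by $\tau_{ij}$ is $\sigma\mapsto\tau_{ij}\sigma\tau_{ij}^{-1}$, and the partial conjugation $\mathbf i^j$ is $\sigma=\theta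 g\mapsto\theta\,\tau_{ij}\,g\,\tau_{ij}^{-1}$, where $\sigma=\theta g$ is the decomposition of $\sigma$ according to the semidirect product $\mathcal H(k)=\mathcal H(k-1)\ltimes\ker d_i$ given by the splitting of $d_i$. 1. For every $\sigma\in\mathcal H(k)$ and $1\le r<s<t\le k$ there are unique integers $\alpha,\beta,\gamma,\delta$ such that, after deleting all components other than $r,s,t$, $$\sigma\equiv\tau_{rs}^{\alpha}\tau_{rt}^{\beta}\tau_{st}^{\gamma}[\tau_{rt},\tau_{st}]^{\delta}\pmod{\mathcal H(\{r,s,t\})_3};$$ moreover $\alpha=l_{rs}$, $\beta=l_{rt}$, $\gamma=l_{st}$. Write $\mu(rst)=\delta$ (Milnor's triple linking number), and let $\mu(\sigma)=\{\mu(rst)\}_{r<s<t}\in\mathbb Z^{\binom k3}$. 2. Fix integers $l_{ij}=l_{ji}$ with $l_{ii}=0$. Every vector of $\mathbb Z^{\binom k3}$ equals $\mu(\sigma)$ for some $\sigma$ with linking numbers $l_{ij}$. For all $i\ne j$, the conjugation by $\tau_{ij}$ and the partial conjugation $\mathbf i^j$ preserve linking numbers and, on the $\sigma$ with linking numbers $l_{ij}$,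 each of them changes $\mu(\sigma)$ by adding a vector of $\mathbb Z^{\binom k3}$ that does not depend on $\sigma$ and is uniquely determined. Denote the vector of the partial conjugation $\mathbf i^j$ again by $\mathbf i^j$. 3. For all $i\neq j$, the translation vector of the conjugation by $\tau_{ij}$ equals $\mathbf i^j+\mathbf j^i$. 4. For every $i=1,\dots,k$, $$\sum_{j\ne i}\mathbf j^i=0,\qquad \sum_{j\ne i}l_{ij}\,\mathbf i^j=0 .$$ -/

import Mathlib

/-!
String links up to link-homotopy, in their standard combinatorial model: the pure braid group in
Artin's presentation, modulo the relations saying that every standard generator commutes with all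
of its conjugates (the homotopy braid group of Goldsmith, which is the group of link-homotopy
classes of string links by Habegger and Lin).  The components are indexed by an arbitrary linear
order, so that one can delete components without renumbering the others.
-/

open scoped commutatorElement

/-- The generators of the pure braid group: pairs of components `i < j`. -/
abbrev PureGen (ι : Type) [LinearOrder ι] : Type := {p : ι × ι // p.1 < p.2}

/-- The letter `A_{ij}`, for `i < j`, in the free group on the generators. -/
def letterA {ι : Type} [LinearOrder ι] (i j : ι) (h : i < j) : FreeGroup (PureGen ι) :=
  FreeGroup.of ⟨(i, j), h⟩

/-- Artin's relations `u = v` between the generators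
`A_{ij} = σ_{j-1} ⋯ σ_{i+1} σ_i² σ_{i+1}⁻¹ ⋯ σ_{j-1}⁻¹` of the pure braid group, giving the action
of `A_{rs}` on `A_{ij}` whenever `r < s < j` and `i < j`. -/
inductive ArtinRel {ι : Type} [LinearOrder ι] :
    FreeGroup (PureGen ι) → FreeGroup (PureGen ι) → Prop
  /-- `A_{rs}⁻¹ A_{ij} A_{rs} = A_{ij}` for `r < s < i < j`. -/
  | disjoint (r s i j : ι) (hrs : r < s) (hsi : s < i) (hij : i < j) :
      ArtinRel ((letterA r s hrs)⁻¹ * letterA i j hij * letterA r s hrs) (letterA i j hij)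
  /-- `A_{rs}⁻¹ A_{ij} A_{rs} = A_{ij}` for `i < r < s < j`. -/
  | nested (i r s j : ι) (hir : i < r) (hrs : r < s) (hsj : s < j) :
      ArtinRel
        ((letterA r s hrs)⁻¹ * letterA i j (hir.trans (hrs.trans hsj)) * letterA r s hrs)
        (letterA i j (hir.trans (hrs.trans hsj)))
  /-- `A_{rs}⁻¹ A_{sj} A_{rs} = A_{rj} A_{sj} A_{rj}⁻¹` for `r < s < j`. -/
  | right (r s j : ι) (hrs : r < s) (hsj : s < j) :
      ArtinRel
        ((letterA r s hrs)⁻¹ * letterA s j hsj * letterA r s hrs)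
        (letterA r j (hrs.trans hsj) * letterA s j hsj * (letterA r j (hrs.trans hsj))⁻¹)
  /-- `A_{rs}⁻¹ A_{rj} A_{rs} = (A_{rj} A_{sj}) A_{rj} (A_{rj} A_{sj})⁻¹` for `r < s < j`. -/
  | left (r s j : ι) (hrs : r < s) (hsj : s < j) :
      ArtinRel
        ((letterA r s hrs)⁻¹ * letterA r j (hrs.trans hsj) * letterA r s hrs)
        ((letterA r j (hrs.trans hsj) * letterA s j hsj) * letterA r j (hrs.trans hsj) *
          (letterA r j (hrs.trans hsj) * letterA s j hsj)⁻¹)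
  /-- `A_{rs}⁻¹ A_{ij} A_{rs} = [A_{rj}, A_{sj}] A_{ij} [A_{rj}, A_{sj}]⁻¹` for
  `r < i < s < j`. -/
  | crossing (r i s j : ι) (hri : r < i) (his : i < s) (hsj : s < j) :
      ArtinRel
        ((letterA r s (hri.trans his))⁻¹ * letterA i j (his.trans hsj) *
          letterA r s (hri.trans his))
        (⁅letterA r j (hri.trans (his.trans hsj)), letterA s j hsj⁆ *
          letterA i j (his.trans hsj) *
          ⁅letterA r j (hri.trans (his.trans hsj)), letterA s j hsj⁆⁻¹)

/-- The pure braid group on strands indexed by `ι`. -/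
abbrev PureBraid (ι : Type) [LinearOrder ι] : Type :=
  PresentedGroup {w : FreeGroup (PureGen ι) | ∃ u v, ArtinRel u v ∧ w = u * v⁻¹}

/-- A map on generators respecting Artin's relations extends to the pure braid group. -/
def PureBraid.lift {ι : Type} [LinearOrder ι] {G : Type} [Group G] (f : PureGen ι → G)
    (hf : ∀ u v, ArtinRel u v → FreeGroup.lift f u = FreeGroup.lift f v) : PureBraid ι →* G :=
  PresentedGroup.toGroup (f := f) (by
    rintro w ⟨u, v, huv, rfl⟩
    rw [map_mul, map_inv, hf u v huv, mul_inv_cancel])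

/-- The pure braid `τ_{ij} = τ_{ji}` for `i ≠ j` (and, by convention, `1` for `i = j`). -/
def PureBraid.tau {ι : Type} [LinearOrder ι] (i j : ι) : PureBraid ι :=
  if h : i < j then PresentedGroup.of ⟨(i, j), h⟩
  else if h : j < i then PresentedGroup.of ⟨(j, i), h⟩
  else 1

/-- The pure braids that are trivial up to link-homotopy: the normal subgroup generated by the
commutators of the `τ_{ij}` with their own conjugates. -/
abbrev linkHomotopySubgroup (ι : Type) [LinearOrder ι] : Subgroup (PureBraid ι) :=
  Subgroup.normalClosure
    {x | ∃ (i j : ι) (g : PureBraid ι),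
      x = ⁅PureBraid.tau i j, g * PureBraid.tau i j * g⁻¹⁆}

/-- The group `H(ι)` of link-homotopy classes of string links with components indexed by `ι`. -/
abbrev HGroup (ι : Type) [LinearOrder ι] : Type := PureBraid ι ⧸ linkHomotopySubgroup ι

namespace HGroup

/-- The class of `τ_{ij}` in `H(ι)`. -/
def tau {ι : Type} [LinearOrder ι] (i j : ι) : HGroup ι :=
  QuotientGroup.mk' (linkHomotopySubgroup ι) (PureBraid.tau i j)

/-- A map on generators that respects Artin's relations and under which every generator commutes
with all its conjugates (by elements of the image) extends to `H(ι)`. -/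
def lift {ι : Type} [LinearOrder ι] {G : Type} [Group G] (f : PureGen ι → G)
    (hf : ∀ u v, ArtinRel u v → FreeGroup.lift f u = FreeGroup.lift f v)
    (hc : ∀ (p : PureGen ι) (g : G), ⁅f p, g * f p * g⁻¹⁆ = 1) : HGroup ι →* G :=
  QuotientGroup.lift (linkHomotopySubgroup ι) (PureBraid.lift f hf) (by
    have key : linkHomotopySubgroup ι ≤ (PureBraid.lift f hf).ker := by
      refine Subgroup.normalClosure_le_normal ?_
      rintro x ⟨i, j, g, rfl⟩
      rw [SetLike.mem_coe, MonoidHom.mem_ker, map_commutatorElement, map_mul, map_mul, map_inv]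
      unfold PureBraid.tau
      split_ifs with h1 h2
      · rw [PureBraid.lift, PresentedGroup.toGroup.of]
        exact hc _ _
      · rw [PureBraid.lift, PresentedGroup.toGroup.of]
        exact hc _ _
      · simp
    exact fun x hx => key hx)

theorem lift_tau {ι : Type} [LinearOrder ι] {G : Type} [Group G] (f : PureGen ι → G)
    (hf : ∀ u v, ArtinRel u v → FreeGroup.lift f u = FreeGroup.lift f v)
    (hc : ∀ (p : PureGen ι) (g : G), ⁅f p, g * f p * g⁻¹⁆ = 1) (i j : ι) (h : i < j) :
    lift f hf hc (tau i j) = f ⟨(i, j), h⟩ := by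
  simp [lift, tau, PureBraid.tau, h, PureBraid.lift]

theorem tau_comm {ι : Type} [LinearOrder ι] (i j : ι) : tau i j = tau j i := by
  unfold tau PureBraid.tau
  rcases lt_trichotomy i j with h | h | h
  · simp [h, h.not_gt]
  · simp [h]
  · simp [h, h.not_gt]

theorem tau_self {ι : Type} [LinearOrder ι] (i : ι) : tau i i = 1 := by
  simp [tau, PureBraid.tau]

/-- Artin's relations hold in `H(ι)`. -/
theorem lift_tau_rel {ι : Type} [LinearOrder ι] {u v : FreeGroup (PureGen ι)}
    (h : ArtinRel u v) :
    FreeGroup.lift (fun p : PureGen ι => tau p.1.1 p.1.2) u =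
      FreeGroup.lift (fun p : PureGen ι => tau p.1.1 p.1.2) v := by
  have e : FreeGroup.lift (fun p : PureGen ι => tau p.1.1 p.1.2) =
      (QuotientGroup.mk' (linkHomotopySubgroup ι)).comp (PresentedGroup.mk _) := by
    ext p
    have hp := p.2
    simp only [FreeGroup.lift_apply_of, tau, PureBraid.tau, hp, dif_pos, MonoidHom.comp_apply]
    rfl
  have e2 : PresentedGroup.mk {w : FreeGroup (PureGen ι) | ∃ u v, ArtinRel u v ∧ w = u * v⁻¹}
      (u * v⁻¹) = 1 :=
    PresentedGroup.one_of_mem ⟨u, v, h, rfl⟩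
  rw [map_mul, map_inv, mul_inv_eq_one] at e2
  rw [e, MonoidHom.comp_apply, MonoidHom.comp_apply, e2]

theorem tau_commutes {ι : Type} [LinearOrder ι] (i j : ι) (g : HGroup ι) :
    ⁅tau i j, g * tau i j * g⁻¹⁆ = 1 := by
  obtain ⟨g, rfl⟩ := QuotientGroup.mk'_surjective (linkHomotopySubgroup ι) g
  unfold tau
  rw [← map_inv, ← map_mul, ← map_mul, ← map_commutatorElement, ← MonoidHom.mem_ker,
    QuotientGroup.ker_mk']
  exact Subgroup.subset_normalClosure ⟨i, j, g, rfl⟩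

open Classical in
/-- The image of `τ_{ij}` (`i < j`) under deletion of the components outside `S`. -/
noncomputable def delGen {ι : Type} [LinearOrder ι] (S : Set ι) (p : PureGen ι) : HGroup S :=
  if h : p.1.1 ∈ S ∧ p.1.2 ∈ S then tau ⟨p.1.1, h.1⟩ ⟨p.1.2, h.2⟩ else 1

theorem delGen_rel {ι : Type} [LinearOrder ι] (S : Set ι) {u v : FreeGroup (PureGen ι)}
    (huv : ArtinRel u v) : FreeGroup.lift (delGen S) u = FreeGroup.lift (delGen S) v := by
  cases huv with
  | disjoint r s i j hrs hsi hij =>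
    have H := fun a b c d => lift_tau_rel (ι := S)
      (ArtinRel.disjoint ⟨r, a⟩ ⟨s, b⟩ ⟨i, c⟩ ⟨j, d⟩ hrs hsi hij)
    by_cases a : r ∈ S <;> by_cases b : s ∈ S <;> by_cases c : i ∈ S <;>
      by_cases d : j ∈ S <;> simp_all [letterA, delGen]
  | nested i r s j hir hrs hsj =>
    have H := fun a b c d => lift_tau_rel (ι := S)
      (ArtinRel.nested ⟨i, a⟩ ⟨r, b⟩ ⟨s, c⟩ ⟨j, d⟩ hir hrs hsj)
    by_cases a : i ∈ S <;> by_cases b : r ∈ S <;> by_cases c : s ∈ S <;>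
      by_cases d : j ∈ S <;> simp_all [letterA, delGen]
  | right r s j hrs hsj =>
    have H := fun a b c => lift_tau_rel (ι := S)
      (ArtinRel.right ⟨r, a⟩ ⟨s, b⟩ ⟨j, c⟩ hrs hsj)
    by_cases a : r ∈ S <;> by_cases b : s ∈ S <;> by_cases c : j ∈ S <;>
      simp_all [letterA, delGen]
  | left r s j hrs hsj =>
    have H := fun a b c => lift_tau_rel (ι := S)
      (ArtinRel.left ⟨r, a⟩ ⟨s, b⟩ ⟨j, c⟩ hrs hsj)
    by_cases a : r ∈ S <;> by_cases b : s ∈ S <;> by_cases c : j ∈ S <;>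
      simp_all [letterA, delGen]
  | crossing r i s j hri his hsj =>
    have H := fun a b c d => lift_tau_rel (ι := S)
      (ArtinRel.crossing ⟨r, a⟩ ⟨i, b⟩ ⟨s, c⟩ ⟨j, d⟩ hri his hsj)
    by_cases a : r ∈ S <;> by_cases b : i ∈ S <;> by_cases c : s ∈ S <;>
      by_cases d : j ∈ S <;> simp_all [letterA, delGen]
    rw [← commutatorElement_inv, inv_mul_cancel]

/-- Deletion of the components outside `S`: `τ_{ij}` is sent to `τ_{ij}` if `i, j ∈ S` and to `1`
otherwise. -/
noncomputable def del {ι : Type} [LinearOrder ι] (S : Set ι) : HGroup ι →* HGroup S :=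
  lift (delGen S) (fun _ _ huv => delGen_rel S huv)
    (by
      intro p g
      unfold delGen
      split_ifs with h
      · exact tau_commutes _ _ _
      · simp)

/-- Insertion of trivial components, `τ_{ij} ↦ τ_{ij}`: the section of `del S`. -/
def incl {ι : Type} [LinearOrder ι] (S : Set ι) : HGroup S →* HGroup ι :=
  lift (fun p => tau p.1.1.1 p.1.2.1)
    (by
      intro u v huv
      cases huv with
      | disjoint r s i j hrs hsi hij =>
        simpa [letterA] using lift_tau_rel (ArtinRel.disjoint r.1 s.1 i.1 j.1 hrs hsi hij)
      | nested i r s j hir hrs hsj =>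
        simpa [letterA] using lift_tau_rel (ArtinRel.nested i.1 r.1 s.1 j.1 hir hrs hsj)
      | right r s j hrs hsj =>
        simpa [letterA] using lift_tau_rel (ArtinRel.right r.1 s.1 j.1 hrs hsj)
      | left r s j hrs hsj =>
        simpa [letterA] using lift_tau_rel (ArtinRel.left r.1 s.1 j.1 hrs hsj)
      | crossing r i s j hri his hsj =>
        simpa [letterA] using lift_tau_rel (ArtinRel.crossing r.1 i.1 s.1 j.1 hri his hsj))
    (fun p g => tau_commutes p.1.1.1 p.1.2.1 g)

/-- The linking number `l_{ij}`, as a homomorphism: the exponent sum of `τ_{ij}`. -/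
def linkHom {ι : Type} [LinearOrder ι] (i j : ι) : HGroup ι →* Multiplicative ℤ :=
  lift (fun p => if p.1 = (i, j) ∨ p.1 = (j, i) then Multiplicative.ofAdd 1 else 1)
    (by
      intro u v huv
      apply Multiplicative.toAdd.injective
      cases huv <;> simp only [map_mul, map_inv, commutatorElement_def, toAdd_mul, toAdd_inv] <;>
        ring)
    (by
      intro p g
      apply Multiplicative.toAdd.injective
      simp only [commutatorElement_def, toAdd_mul, toAdd_inv, toAdd_one, mul_inv_rev]
      ring)

/-- The linking number `l_{ij}(σ)`. -/
def lk {ι : Type} [LinearOrder ι] (σ : HGroup ι) (i j : ι) : ℤ :=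
  Multiplicative.toAdd (linkHom i j σ)

/-- `d_i`: deletion of the `i`-th component. -/
noncomputable abbrev d {ι : Type} [LinearOrder ι] (i : ι) :
    HGroup ι →* HGroup ({i}ᶜ : Set ι) := del {i}ᶜ

theorem del_incl {ι : Type} [LinearOrder ι] (S : Set ι) (θ : HGroup S) :
    del S (incl S θ) = θ := by
  have e : (del S).comp (incl S) = MonoidHom.id _ := by
    ext p
    have hp : p.1.1.1 < p.1.2.1 := p.2
    have h1 : incl S (tau p.1.1 p.1.2) = tau p.1.1.1 p.1.2.1 := lift_tau _ _ _ _ _ p.2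
    have h2 : del S (tau p.1.1.1 p.1.2.1) = tau p.1.1 p.1.2 := by
      rw [del, lift_tau _ _ _ _ _ hp]
      simp [delGen]
    have h3 : tau p.1.1 p.1.2 = QuotientGroup.mk' (linkHomotopySubgroup S)
        (PresentedGroup.of p) := by
      have hp' := p.2
      simp only [tau, PureBraid.tau, hp', dif_pos]
    have h4 : del S (incl S (tau p.1.1 p.1.2)) = tau p.1.1 p.1.2 := by rw [h1, h2]
    rw [h3] at h4
    exact h4
  exact DFunLike.congr_fun e θ

/-- `τ_{ij}` lies in the kernel of `d_i`. -/
theorem d_tau {ι : Type} [LinearOrder ι] (i j : ι) : d i (tau i j) = 1 := by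
  rcases lt_trichotomy i j with h | h | h
  · rw [d, del, lift_tau _ _ _ _ _ h]; simp [delGen]
  · subst h; rw [tau_self, map_one]
  · rw [tau_comm, d, del, lift_tau _ _ _ _ _ h]; simp [delGen]

/-- In the semidirect decomposition `H(k) = H(k-1) ⋉ RF(k-1)` attached to the split exact sequence
`1 → RF(k-1) → H(k) → H(k-1) → 1` of `d_i`, the component `θ` of `σ = θ g`. -/
noncomputable def theta {ι : Type} [LinearOrder ι] (i : ι) (σ : HGroup ι) : HGroup ι :=
  incl {i}ᶜ (d i σ)

/-- The component `g` of `σ = θ g`, an element of the kernel `RF(k-1)` of `d_i`. -/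
noncomputable def kerPart {ι : Type} [LinearOrder ι] (i : ι) (σ : HGroup ι) : (d i).ker :=
  ⟨(theta i σ)⁻¹ * σ, by
    rw [MonoidHom.mem_ker, map_mul, map_inv, theta, d, del_incl, inv_mul_cancel]⟩

/-- The partial conjugation `σ = θ g ↦ θ h g h⁻¹`, for `h` in the kernel of `d_i`. -/
noncomputable def partialConj {ι : Type} [LinearOrder ι] (i : ι) (h : (d i).ker)
    (σ : HGroup ι) : HGroup ι :=
  theta i σ * ((h * kerPart i σ * h⁻¹ : (d i).ker) : HGroup ι)

/-- The partial conjugation `𝐢^j`: the `i`-th component is singled out and one takes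
`h = τ_{ij}`. -/
noncomputable def pconj {ι : Type} [LinearOrder ι] (i j : ι) (σ : HGroup ι) : HGroup ι :=
  partialConj i ⟨tau i j, d_tau i j⟩ σ

/-- The conjugation by `τ_{ij}`. -/
def conj {ι : Type} [LinearOrder ι] (i j : ι) (σ : HGroup ι) : HGroup ι :=
  tau i j * σ * (tau i j)⁻¹

/-- After deleting all components other than `r, s, t`, the string link `σ` equals
`τ_{rs}^α τ_{rt}^β τ_{st}^γ [τ_{rt}, τ_{st}]^δ` modulo the third term of the lower central series.
(Mathlib's numbering of the lower central series starts from `0`.) -/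
def IsNormalForm {ι : Type} [LinearOrder ι] (σ : HGroup ι) (r s t : ι) (α β γ δ : ℤ) : Prop :=
  let r' : ({r, s, t} : Set ι) := ⟨r, by simp⟩
  let s' : ({r, s, t} : Set ι) := ⟨s, by simp⟩
  let t' : ({r, s, t} : Set ι) := ⟨t, by simp⟩
  (tau r' s' ^ α * tau r' t' ^ β * tau s' t' ^ γ * ⁅tau r' t', tau s' t'⁆ ^ δ)⁻¹ *
      del {r, s, t} σ ∈
    (⊤ : Subgroup (HGroup ({r, s, t} : Set ι))).lowerCentralSeries 2

/-- Milnor's triple linking number `μ(rst)` of `σ`: the exponent `δ` in the normal form. -/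
noncomputable def mu {ι : Type} [LinearOrder ι] (σ : HGroup ι) (r s t : ι) : ℤ :=
  Classical.epsilon fun δ => ∃ α β γ : ℤ, IsNormalForm σ r s t α β γ δ

end HGroup

/-- Triples `1 ≤ r < s < t ≤ k`. -/
structure Triple (k : ℕ) where
  r : Fin k
  s : Fin k
  t : Fin k
  hrs : r < s
  hst : s < t

/-- The lattice `ℤ^{k choose 3}`, with coordinates indexed by the triples `r < s < t`. -/
abbrev MuLattice (k : ℕ) : Type := Triple k → ℤ

/-- The vector `{μ(rst)}` of a string link. -/
noncomputable def muVec {k : ℕ} (σ : HGroup (Fin k)) : MuLattice k :=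
  fun p => σ.mu p.r p.s p.t

/-- The operation `F` on string links preserves the linking numbers `l`, and on the lattice
of `μ`-vectors of string links with linking numbers `l` it induces the translation by `T`. -/
def InducesTranslation {k : ℕ} (l : Fin k → Fin k → ℤ) (F : HGroup (Fin k) → HGroup (Fin k))
    (T : MuLattice k) : Prop :=
  ∀ σ : HGroup (Fin k), σ.lk = l → (F σ).lk = l ∧ muVec (F σ) = muVec σ + T

/-! For each triple $r<s<t$, everything is read off in one class-two nilpotent group. Send
$\tau_{rs},\tau_{rt},\tau_{st}$ to $x,y,z$ and all other generators to $1$. Modulo triple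
commutators, Artin's relations for the triple say exactly $[x,y]=[y,z]=[z,x]$, and the link-homotopy
relations hold automatically. The resulting `milnorHom` to `Heis` has the third lower central term
as its kernel when there are only three components (`milnorHom_eq_one_iff`). A normal form is
therefore the coordinate vector of the image: three linking numbers and $\mu(rst)$.

In `Heis`, conjugating $g$ by $h$ adds to the last coordinate an alternating form in the abelianized
coordinates, that is, in linking numbers (`muVec_mul_conj`). Hence conjugations and partial
conjugations act on $\mu$ by translations. In $\mathbf i^j$ only $\ker d_i$ is conjugated, and that
part of $\sigma$ carries just the linking numbers involving $i$ (`lk_kerPart`). Consequently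
$\mathbf i^j$ has coordinate $\varepsilon(i,j,m)\,l_{im}$ on a triple $\{i,j,m\}$, where
$\varepsilon$ is the sign of the ordering relative to the increasing one, and $0$ on triples not
containing both $i$ and $j$. Conjugation by $\tau_{ij}$ gives $\varepsilon(i,j,m)(l_{im}-l_{jm})$.
The three relations follow from the antisymmetry of $\varepsilon$.

For surjectivity, the commutators $[\tau_{rt},\tau_{st}]$ have no linking and change one coordinate
of $\mu$ each. -/

/-! ### The class-two target group. -/

/-- The free nilpotent group of class two on three generators `x, y, z`, modulo
`[x, y] = [y, z] = [x, z]⁻¹`. The element `(a, b, c, d)` stands for `x ^ a y ^ b z ^ c [y, z] ^ d`. -/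
@[ext]
structure Heis where
  a : ℤ
  b : ℤ
  c : ℤ
  d : ℤ

namespace Heis

/-- The cocycle that describes the multiplication. -/
def cocycle (b c a' b' : ℤ) : ℤ := c * a' - b * a' - c * b'

/-- The cocycle collects the powers of the central $w=[y,z]$ produced by sorting $x^ay^bz^c\cdot
x^{a'}y^{b'}z^{c'}$: $z$ past $x$ gives $w$, while $y$ past $x$ and $z$ past $y$ give $w^{-1}$. -/
instance : Mul Heis :=
  ⟨fun g h => ⟨g.a + h.a, g.b + h.b, g.c + h.c, g.d + h.d + cocycle g.b g.c h.a h.b⟩⟩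
instance : One Heis := ⟨⟨0, 0, 0, 0⟩⟩
instance : Inv Heis := ⟨fun g => ⟨-g.a, -g.b, -g.c, -g.d + cocycle g.b g.c g.a g.b⟩⟩

@[simp] theorem mul_a (g h : Heis) : (g * h).a = g.a + h.a := rfl
@[simp] theorem mul_b (g h : Heis) : (g * h).b = g.b + h.b := rfl
@[simp] theorem mul_c (g h : Heis) : (g * h).c = g.c + h.c := rfl
@[simp] theorem mul_d (g h : Heis) :
    (g * h).d = g.d + h.d + cocycle g.b g.c h.a h.b := rfl
@[simp] theorem one_a : (1 : Heis).a = 0 := rfl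
@[simp] theorem one_b : (1 : Heis).b = 0 := rfl
@[simp] theorem one_c : (1 : Heis).c = 0 := rfl
@[simp] theorem one_d : (1 : Heis).d = 0 := rfl
@[simp] theorem inv_a (g : Heis) : g⁻¹.a = -g.a := rfl
@[simp] theorem inv_b (g : Heis) : g⁻¹.b = -g.b := rfl
@[simp] theorem inv_c (g : Heis) : g⁻¹.c = -g.c := rfl
@[simp] theorem inv_d (g : Heis) : g⁻¹.d = -g.d + cocycle g.b g.c g.a g.b := rfl

instance : Group Heis :=
  Group.ofLeftAxioms
    (fun g h k => by
      ext <;> simp [cocycle] <;> ring)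
    (fun g => by ext <;> simp [cocycle])
    (fun g => by ext <;> simp [cocycle])

/-- The alternating form that describes the commutators. -/
def form (a b c a' b' c' : ℤ) : ℤ := cocycle b c a' b' - cocycle b' c' a b

theorem commutator_eq (g h : Heis) :
    ⁅g, h⁆ = ⟨0, 0, 0, form g.a g.b g.c h.a h.b h.c⟩ := by
  ext <;> simp [commutatorElement_def, form, cocycle]
  ring

theorem conj_eq (g h : Heis) :
    g * h * g⁻¹ = ⟨h.a, h.b, h.c, h.d + form g.a g.b g.c h.a h.b h.c⟩ := by
  ext <;> simp [form, cocycle]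
  ring

theorem inv_conj_eq (g h : Heis) :
    g⁻¹ * h * g = ⟨h.a, h.b, h.c, h.d - form g.a g.b g.c h.a h.b h.c⟩ := by
  ext <;> simp [form, cocycle]
  ring

/-- An element and its conjugate differ only in the central coordinate, and the form is alternating.
This supplies the link-homotopy relations for free. -/
theorem commutator_conj (g h : Heis) : ⁅g, h * g * h⁻¹⁆ = 1 := by
  rw [conj_eq, commutator_eq]
  ext <;> simp [form]

theorem commutator_commutator (g h k : Heis) : ⁅⁅g, h⁆, k⁆ = 1 := by
  rw [commutator_eq, commutator_eq]
  ext <;> simp [form, cocycle]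

theorem lowerCentralSeries_two : (⊤ : Subgroup Heis).lowerCentralSeries 2 = ⊥ := by
  rw [Subgroup.lowerCentralSeries_succ, Subgroup.lowerCentralSeries_succ,
    Subgroup.lowerCentralSeries_zero, Subgroup.commutator_eq_bot_iff_le_centralizer,
    Subgroup.commutator_le]
  intro g _ h _
  rw [Subgroup.mem_centralizer_iff_commutator_eq_one]
  intro k _
  rw [← commutatorElement_inv, commutator_commutator, inv_one]

theorem zpow_x (n : ℤ) : (⟨1, 0, 0, 0⟩ : Heis) ^ n = ⟨n, 0, 0, 0⟩ := by
  induction n with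
  | zero => rfl
  | succ n ih => rw [zpow_add_one, ih]; ext <;> simp [cocycle]
  | pred n ih => rw [zpow_sub_one, ih]; ext <;> simp [cocycle]; ring

theorem zpow_y (n : ℤ) : (⟨0, 1, 0, 0⟩ : Heis) ^ n = ⟨0, n, 0, 0⟩ := by
  induction n with
  | zero => rfl
  | succ n ih => rw [zpow_add_one, ih]; ext <;> simp [cocycle]
  | pred n ih => rw [zpow_sub_one, ih]; ext <;> simp [cocycle]; ring

theorem zpow_z (n : ℤ) : (⟨0, 0, 1, 0⟩ : Heis) ^ n = ⟨0, 0, n, 0⟩ := by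
  induction n with
  | zero => rfl
  | succ n ih => rw [zpow_add_one, ih]; ext <;> simp [cocycle]
  | pred n ih => rw [zpow_sub_one, ih]; ext <;> simp [cocycle]; ring

theorem zpow_w (m n : ℤ) : (⟨0, 0, 0, m⟩ : Heis) ^ n = ⟨0, 0, 0, n * m⟩ := by
  induction n with
  | zero => ext <;> simp
  | succ n ih => rw [zpow_add_one, ih]; ext <;> simp [cocycle]; ring
  | pred n ih => rw [zpow_sub_one, ih]; ext <;> simp [cocycle]; ring

theorem normalForm (α β γ δ : ℤ) :
    (⟨1, 0, 0, 0⟩ : Heis) ^ α * ⟨0, 1, 0, 0⟩ ^ β * ⟨0, 0, 1, 0⟩ ^ γ *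
      ⁅(⟨0, 1, 0, 0⟩ : Heis), ⟨0, 0, 1, 0⟩⁆ ^ δ = ⟨α, β, γ, δ⟩ := by
  rw [zpow_x, zpow_y, zpow_z, commutator_eq, zpow_w]
  ext <;> simp [cocycle, form]

end Heis

/-- When the commutator $w$ of $x$ and $y$ is central, the commutator of powers is bilinear in the
exponents; the proof raises first $y$, then $x$, to a power. -/
theorem zpow_mul_zpow_of_mul_eq {G : Type*} [Group G] {x y w : G} (hw : ∀ g, Commute w g)
    (h : x * y = w * (y * x)) (a b : ℤ) : y ^ b * x ^ a = w ^ (-(a * b)) * (x ^ a * y ^ b) := by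
  have h1 : SemiconjBy x y (w * y) := by rw [SemiconjBy, h, mul_assoc]
  have h2 := h1.zpow_right b
  rw [(hw y).mul_zpow] at h2
  have h3 : SemiconjBy (y ^ b) x (w ^ (-b) * x) := by
    rw [SemiconjBy, mul_assoc, h2.eq, zpow_neg]
    group
  have h4 := h3.zpow_right a
  rw [((hw x).zpow_left _).mul_zpow, ← zpow_mul] at h4
  rw [h4.eq, mul_assoc]
  congr 2
  ring

/-- The homomorphism to a group with elements that satisfy the relations of `Heis`. -/
def Heis.lift {G : Type*} [Group G] (x y z w : G) (hw : ∀ g, Commute w g)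
    (hxy : x * y = w * (y * x)) (hzx : z * x = w * (x * z)) (hyz : y * z = w * (z * y)) :
    Heis →* G where
  toFun g := x ^ g.a * y ^ g.b * z ^ g.c * w ^ g.d
  map_one' := by simp
  map_mul' g h := by
    have e1 := zpow_mul_zpow_of_mul_eq hw hxy h.a g.b
    have e2 : z ^ g.c * x ^ h.a = w ^ (g.c * h.a) * (x ^ h.a * z ^ g.c) := by
      rw [zpow_mul_zpow_of_mul_eq hw hzx g.c h.a, ← mul_assoc, ← zpow_add]
      simp
    have e3 := zpow_mul_zpow_of_mul_eq hw hyz h.b g.c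
    have c (u : G) (m n : ℤ) : u ^ m * w ^ n = w ^ n * u ^ m := (((hw _).zpow_left n).eq).symm
    have c' (u : G) (m n : ℤ) (v : G) : u ^ m * (w ^ n * v) = w ^ n * (u ^ m * v) := by
      rw [← mul_assoc, c, mul_assoc]
    -- The sorting rules carry a trailing factor $v$ so that they apply inside right-associated
    -- products.
    have l1 (v : G) : y ^ g.b * (x ^ h.a * v) = w ^ (-(h.a * g.b)) * (x ^ h.a * (y ^ g.b * v)) := by
      rw [← mul_assoc, e1]; simp only [mul_assoc]
    have l2 (v : G) : z ^ g.c * (x ^ h.a * v) = w ^ (g.c * h.a) * (x ^ h.a * (z ^ g.c * v)) := by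
      rw [← mul_assoc, e2]; simp only [mul_assoc]
    have l3 (v : G) : z ^ g.c * (y ^ h.b * v) = w ^ (-(h.b * g.c)) * (y ^ h.b * (z ^ g.c * v)) := by
      rw [← mul_assoc, e3]; simp only [mul_assoc]
    simp only [mul_a, mul_b, mul_c, mul_d, zpow_add, mul_assoc, c z, c' x, c' y, c' z, l1, l2, l3, cocycle,
      sub_eq_add_neg]
    simp only [← mul_assoc, ← zpow_add]
    congr 7
    ring

/-! ### The homomorphism attached to a triple. -/

namespace HGroup

/-- The image in `Heis` of a generator, for the triple `r, s, t`. -/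
def milnorGen {ι : Type} [LinearOrder ι] (r s t : ι) (p : PureGen ι) : Heis :=
  ⟨if p.1 = (r, s) then 1 else 0, if p.1 = (r, t) then 1 else 0, if p.1 = (s, t) then 1 else 0, 0⟩

/-- Each relation equates two conjugates of one generator, so only central coordinates matter. They
vanish unless the relation is `right` or `left` for the chosen triple itself; those two are the
relations built into `Heis`. -/
theorem milnorGen_rel {ι : Type} [LinearOrder ι] {r s t : ι} (hrs : r < s) (hst : s < t)
    {u v : FreeGroup (PureGen ι)} (huv : ArtinRel u v) :
    FreeGroup.lift (milnorGen r s t) u = FreeGroup.lift (milnorGen r s t) v := by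
  cases huv <;>
  · simp only [letterA, map_mul, map_inv, map_commutatorElement, FreeGroup.lift_apply_of,
      Heis.conj_eq, Heis.inv_conj_eq, Heis.mul_a, Heis.mul_b, Heis.mul_c, milnorGen, Heis.form,
      Heis.cocycle, Prod.mk.injEq, Heis.commutator_eq, Heis.mk.injEq, true_and]
    grind

/-- The homomorphism to `Heis` that records the linking numbers and Milnor's triple linking number
of the components `r < s < t`. -/
def milnorHom {ι : Type} [LinearOrder ι] {r s t : ι} (hrs : r < s) (hst : s < t) :
    HGroup ι →* Heis :=
  lift (milnorGen r s t) (fun _ _ huv => milnorGen_rel hrs hst huv)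
    (fun _ _ => Heis.commutator_conj _ _)

theorem hom_ext {ι : Type} [LinearOrder ι] {G : Type*} [Group G] {f g : HGroup ι →* G}
    (h : ∀ i j, i < j → f (tau i j) = g (tau i j)) : f = g := by
  ext p
  have e : (QuotientGroup.mk' (linkHomotopySubgroup ι)) (PresentedGroup.of p) =
      tau p.1.1 p.1.2 := by
    have hp := p.2
    simp only [tau, PureBraid.tau, hp, dif_pos]
  have := h p.1.1 p.1.2 p.2
  rw [← e] at this
  exact this

theorem milnorHom_tau {ι : Type} [LinearOrder ι] {r s t : ι} (hrs : r < s) (hst : s < t)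
    {i j : ι} (h : i < j) : milnorHom hrs hst (tau i j) = milnorGen r s t ⟨(i, j), h⟩ :=
  lift_tau _ _ _ _ _ h

theorem del_tau_of_mem {ι : Type} [LinearOrder ι] {S : Set ι} {i j : ι} (hi : i ∈ S) (hj : j ∈ S) :
    del S (tau i j) = tau ⟨i, hi⟩ ⟨j, hj⟩ := by
  rcases lt_trichotomy i j with h | h | h
  · rw [del, lift_tau _ _ _ _ _ h]
    simp [delGen, hi, hj]
  · subst h
    simp [tau_self]
  · rw [tau_comm, del, lift_tau _ _ _ _ _ h, tau_comm]
    simp [delGen, hi, hj]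

theorem del_tau_of_not_mem {ι : Type} [LinearOrder ι] {S : Set ι} {i j : ι}
    (h : ¬ (i ∈ S ∧ j ∈ S)) : del S (tau i j) = 1 := by
  rcases lt_trichotomy i j with hij | hij | hij
  · rw [del, lift_tau _ _ _ _ _ hij]
    simp only [delGen, h, dif_neg, not_false_eq_true]
  · subst hij
    simp [tau_self]
  · rw [tau_comm, del, lift_tau _ _ _ _ _ hij]
    rw [and_comm] at h
    simp only [delGen, h, dif_neg, not_false_eq_true]

theorem incl_tau {ι : Type} [LinearOrder ι] {S : Set ι} (i j : S) :
    incl S (tau i j) = tau (i : ι) j := by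
  rcases lt_trichotomy i j with h | h | h
  · exact lift_tau _ _ _ _ _ h
  · subst h
    simp [tau_self]
  · rw [tau_comm i, tau_comm (i : ι)]
    exact lift_tau _ _ _ _ _ h

/-- A generator with a strand outside $S$ dies on both sides, because $r,s,t\in S$. Hence the normal
form of the deleted link can be computed on $\sigma$ itself. -/
theorem milnorHom_del {ι : Type} [LinearOrder ι] {S : Set ι} {r s t : S} (hrs : r < s)
    (hst : s < t) (σ : HGroup ι) :
    milnorHom hrs hst (del S σ) =
      milnorHom (Subtype.coe_lt_coe.2 hrs) (Subtype.coe_lt_coe.2 hst) σ := by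
  rw [← MonoidHom.comp_apply]
  congr 1
  refine hom_ext fun i j hij => ?_
  rw [MonoidHom.comp_apply, milnorHom_tau _ _ hij]
  by_cases h : i ∈ S ∧ j ∈ S
  · rw [del_tau_of_mem h.1 h.2, milnorHom_tau hrs hst (Subtype.mk_lt_mk.2 hij)]
    simp [milnorGen, Subtype.ext_iff]
  · rw [del_tau_of_not_mem h, map_one]
    have hr := r.2
    have hs := s.2
    have ht := t.2
    ext <;> simp only [milnorGen, Heis.one_a, Heis.one_b, Heis.one_c, Heis.one_d, Prod.mk.injEq] <;>
      grind

/-! ### Linking numbers. -/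

theorem linkHom_tau {ι : Type} [LinearOrder ι] (a b : ι) {i j : ι} (h : i < j) :
    linkHom a b (tau i j) =
      if (i, j) = (a, b) ∨ (i, j) = (b, a) then Multiplicative.ofAdd 1 else 1 :=
  lift_tau _ _ _ _ _ h

theorem lk_mul {ι : Type} [LinearOrder ι] (σ τ : HGroup ι) (i j : ι) :
    lk (σ * τ) i j = lk σ i j + lk τ i j := by
  simp [lk]

theorem lk_inv {ι : Type} [LinearOrder ι] (σ : HGroup ι) (i j : ι) :
    lk σ⁻¹ i j = -lk σ i j := by
  simp [lk]

theorem lk_one {ι : Type} [LinearOrder ι] (i j : ι) : lk (1 : HGroup ι) i j = 0 := by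
  simp [lk]

theorem lk_zpow {ι : Type} [LinearOrder ι] (σ : HGroup ι) (n : ℤ) (i j : ι) :
    lk (σ ^ n) i j = n * lk σ i j := by
  simp [lk]

theorem lk_tau {ι : Type} [LinearOrder ι] {i j : ι} (hij : i ≠ j) (a b : ι) :
    lk (tau i j) a b = if (i = a ∧ j = b) ∨ (i = b ∧ j = a) then 1 else 0 := by
  rcases hij.lt_or_gt with h | h
  · rw [lk, linkHom_tau a b h]
    simp only [Prod.mk.injEq]
    split_ifs <;> rfl
  · rw [lk, tau_comm, linkHom_tau a b h]
    simp only [Prod.mk.injEq]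
    have : (j = a ∧ i = b ∨ j = b ∧ i = a) ↔ (i = a ∧ j = b ∨ i = b ∧ j = a) := by tauto
    simp only [this]
    split_ifs <;> rfl

theorem lk_comm {ι : Type} [LinearOrder ι] (σ : HGroup ι) (i j : ι) : lk σ i j = lk σ j i := by
  have : linkHom i j = linkHom j i := hom_ext fun a b h => by
    rw [linkHom_tau _ _ h, linkHom_tau _ _ h]
    simp only [or_comm]
  rw [lk, this, lk]

theorem lk_self {ι : Type} [LinearOrder ι] (σ : HGroup ι) (i : ι) : lk σ i i = 0 := by
  have : linkHom i i = 1 := hom_ext fun a b h => by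
    rw [linkHom_tau _ _ h]
    simp only [Prod.mk.injEq, or_self, MonoidHom.one_apply, ite_eq_right_iff]
    rintro ⟨rfl, rfl⟩
    exact absurd h (lt_irrefl _)
  rw [lk, this]
  rfl

theorem milnorHom_coords {ι : Type} [LinearOrder ι] {r s t : ι} (hrs : r < s) (hst : s < t)
    (σ : HGroup ι) :
    (milnorHom hrs hst σ).a = lk σ r s ∧ (milnorHom hrs hst σ).b = lk σ r t ∧
      (milnorHom hrs hst σ).c = lk σ s t := by
  let A : Heis →* Multiplicative ℤ := ⟨⟨fun g => .ofAdd g.a, rfl⟩, fun _ _ => rfl⟩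
  let B : Heis →* Multiplicative ℤ := ⟨⟨fun g => .ofAdd g.b, rfl⟩, fun _ _ => rfl⟩
  let C : Heis →* Multiplicative ℤ := ⟨⟨fun g => .ofAdd g.c, rfl⟩, fun _ _ => rfl⟩
  have hA : A.comp (milnorHom hrs hst) = linkHom r s := hom_ext fun i j h => by
    rw [MonoidHom.comp_apply, milnorHom_tau hrs hst h, linkHom_tau _ _ h]
    have : ¬ (i, j) = (s, r) := by grind
    simp only [this, or_false]
    change Multiplicative.ofAdd (if (i, j) = (r, s) then (1 : ℤ) else 0) = _
    split_ifs <;> rfl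
  have hB : B.comp (milnorHom hrs hst) = linkHom r t := hom_ext fun i j h => by
    rw [MonoidHom.comp_apply, milnorHom_tau hrs hst h, linkHom_tau _ _ h]
    have : ¬ (i, j) = (t, r) := by grind
    simp only [this, or_false]
    change Multiplicative.ofAdd (if (i, j) = (r, t) then (1 : ℤ) else 0) = _
    split_ifs <;> rfl
  have hC : C.comp (milnorHom hrs hst) = linkHom s t := hom_ext fun i j h => by
    rw [MonoidHom.comp_apply, milnorHom_tau hrs hst h, linkHom_tau _ _ h]
    have : ¬ (i, j) = (t, s) := by grind
    simp only [this, or_false]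
    change Multiplicative.ofAdd (if (i, j) = (s, t) then (1 : ℤ) else 0) = _
    split_ifs <;> rfl
  refine ⟨?_, ?_, ?_⟩
  · rw [lk, ← hA]; rfl
  · rw [lk, ← hB]; rfl
  · rw [lk, ← hC]; rfl

/-! ### Normal forms and the triple linking number. -/

/-- The kernel of `milnorHom` for all the components of a three-component string link is the third
term of the lower central series. -/
theorem milnorHom_eq_one_iff {ι : Type} [LinearOrder ι] {r s t : ι} (hrs : r < s) (hst : s < t)
    (h3 : ∀ i : ι, i = r ∨ i = s ∨ i = t) (σ : HGroup ι) :
    milnorHom hrs hst σ = 1 ↔ σ ∈ (⊤ : Subgroup (HGroup ι)).lowerCentralSeries 2 := by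
  set N := (⊤ : Subgroup (HGroup ι)).lowerCentralSeries 2 with hN
  constructor
  · intro hσ
    have hpairs (i j : ι) (h : i < j) :
        (i = r ∧ j = s) ∨ (i = r ∧ j = t) ∨ (i = s ∧ j = t) := by
      rcases h3 i with rfl | rfl | rfl <;> rcases h3 j with rfl | rfl | rfl <;> grind
    let q := QuotientGroup.mk' N
    -- Modulo triple commutators $[y,z]$ is central, as `Heis.lift` requires.
    have hw (g : HGroup ι ⧸ N) : Commute ⁅q (tau r t), q (tau s t)⁆ g := by
      obtain ⟨g, rfl⟩ := QuotientGroup.mk'_surjective N g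
      rw [← commutatorElement_eq_one_iff_commute, ← map_commutatorElement, ← map_commutatorElement,
        ← MonoidHom.mem_ker, QuotientGroup.ker_mk']
      exact Subgroup.commutator_mem_commutator
        (Subgroup.commutator_mem_commutator (Subgroup.mem_top _) (Subgroup.mem_top _))
        (Subgroup.mem_top _)
    have hr := congrArg q (lift_tau_rel (ArtinRel.right r s t hrs hst))
    have hl := congrArg q (lift_tau_rel (ArtinRel.left r s t hrs hst))
    simp only [letterA, map_mul, map_inv, FreeGroup.lift_apply_of] at hr hl
    generalize hx : q (tau r s) = x at *
    generalize hy : q (tau r t) = y at *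
    generalize hz : q (tau s t) = z at *
    have hyz : y * z = ⁅y, z⁆ * (z * y) := by rw [commutatorElement_def]; group
    have hzx : z * x = ⁅y, z⁆ * (x * z) := by
      have : x⁻¹ * z * x = ⁅y, z⁆ * z := by rw [hr, commutatorElement_def]; group
      rw [← mul_assoc, (hw x).eq, mul_assoc, ← this]
      group
    have hxy : x * y = ⁅y, z⁆ * (y * x) := by
      have : y = ⁅y, z⁆ * (x⁻¹ * y * x) := by
        rw [hl, (hw _).eq, commutatorElement_def]; group
      nth_rewrite 1 [this]
      rw [← mul_assoc, ← (hw x).eq]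
      group
    -- The quotient map by the third term factors through `milnorHom`, so an element killed by the
    -- latter lies in that term.
    have key : (Heis.lift x y z ⁅y, z⁆ hw hxy hzx hyz).comp (milnorHom hrs hst) = q := by
      refine hom_ext fun i j hij => ?_
      rw [MonoidHom.comp_apply, milnorHom_tau _ _ hij]
      rcases hpairs i j hij with ⟨rfl, rfl⟩ | ⟨rfl, rfl⟩ | ⟨rfl, rfl⟩
      · simp [Heis.lift, milnorGen, hx, hst.ne, hrs.ne]
      · simp [Heis.lift, milnorGen, hy, hst.ne', hrs.ne]
      · simp [Heis.lift, milnorGen, hz, hst.ne', hrs.ne']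
    rw [← QuotientGroup.ker_mk' N, MonoidHom.mem_ker]
    change q σ = 1
    rw [← key, MonoidHom.comp_apply, hσ, map_one]
  · intro hσ
    have h := Subgroup.mem_map_of_mem (milnorHom hrs hst) hσ
    rw [hN, Subgroup.map_lowerCentralSeries] at h
    have h' := Subgroup.lowerCentralSeries_mono (G := Heis) 2 le_top h
    change _ ∈ (⊤ : Subgroup Heis).lowerCentralSeries 2 at h'
    rwa [Heis.lowerCentralSeries_two, Subgroup.mem_bot] at h'

theorem normalForm_mem_iff {ι : Type} [LinearOrder ι] {S : Set ι} {r s t : S} (hrs : r < s)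
    (hst : s < t) (h3 : ∀ i : S, i = r ∨ i = s ∨ i = t) (σ : HGroup ι) (α β γ δ : ℤ) :
    (tau r s ^ α * tau r t ^ β * tau s t ^ γ * ⁅tau r t, tau s t⁆ ^ δ)⁻¹ * del S σ ∈
        (⊤ : Subgroup (HGroup S)).lowerCentralSeries 2 ↔
      milnorHom (Subtype.coe_lt_coe.2 hrs) (Subtype.coe_lt_coe.2 hst) σ = ⟨α, β, γ, δ⟩ := by
  rw [← milnorHom_eq_one_iff hrs hst h3, map_mul, map_inv, inv_mul_eq_one,
    milnorHom_del hrs hst, eq_comm]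
  simp only [map_mul, map_zpow, map_commutatorElement, milnorHom_tau hrs hst hrs,
    milnorHom_tau hrs hst hst, milnorHom_tau hrs hst (hrs.trans hst)]
  rw [← Heis.normalForm]
  simp [milnorGen, hrs.ne, hrs.ne', hst.ne, hst.ne']

theorem isNormalForm_iff {ι : Type} [LinearOrder ι] {r s t : ι} (hrs : r < s) (hst : s < t)
    (σ : HGroup ι) (α β γ δ : ℤ) :
    IsNormalForm σ r s t α β γ δ ↔ milnorHom hrs hst σ = ⟨α, β, γ, δ⟩ :=
  normalForm_mem_iff (S := {r, s, t}) (r := ⟨r, by simp⟩) (s := ⟨s, by simp⟩) (t := ⟨t, by simp⟩)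
    hrs hst (by
      rintro ⟨i, hi⟩
      simpa [Subtype.ext_iff] using hi) σ α β γ δ

/-- `mu` is a choice by `epsilon`, so it is meaningful only once some normal form is exhibited; the
coordinates of the image provide one. -/
theorem mu_eq {ι : Type} [LinearOrder ι] {r s t : ι} (hrs : r < s) (hst : s < t)
    (σ : HGroup ι) : mu σ r s t = (milnorHom hrs hst σ).d := by
  have h : ∃ δ, ∃ α β γ : ℤ, IsNormalForm σ r s t α β γ δ :=
    ⟨_, _, _, _, (isNormalForm_iff hrs hst σ _ _ _ _).2 rfl⟩
  obtain ⟨α, β, γ, h'⟩ := Classical.epsilon_spec h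
  rw [isNormalForm_iff hrs hst] at h'
  rw [h', mu]

theorem milnorHom_eq {ι : Type} [LinearOrder ι] {r s t : ι} (hrs : r < s) (hst : s < t)
    (σ : HGroup ι) : milnorHom hrs hst σ = ⟨lk σ r s, lk σ r t, lk σ s t, mu σ r s t⟩ := by
  obtain ⟨ha, hb, hc⟩ := milnorHom_coords hrs hst σ
  rw [← ha, ← hb, ← hc, mu_eq hrs hst]


/-! ### The semidirect decomposition and linking numbers. -/

theorem lk_theta {ι : Type} [LinearOrder ι] (i : ι) (σ : HGroup ι) (a b : ι) :
    lk (theta i σ) a b = if a = i ∨ b = i then 0 else lk σ a b := by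
  have e (x y : ι) (h : x < y) :
      incl {i}ᶜ (d i (tau x y)) = if x = i ∨ y = i then 1 else tau x y := by
    by_cases hxy : x = i ∨ y = i
    · rw [if_pos hxy, d, del_tau_of_not_mem, map_one]
      simp only [Set.mem_compl_iff, Set.mem_singleton_iff]
      tauto
    · rw [if_neg hxy]
      rw [not_or] at hxy
      rw [d, del_tau_of_mem (S := {i}ᶜ) hxy.1 hxy.2, incl_tau]
  split_ifs with hab
  · have : ((linkHom a b).comp (incl {i}ᶜ)).comp (d i) = 1 := hom_ext fun x y h => by
      rw [MonoidHom.comp_apply, MonoidHom.comp_apply, e x y h]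
      split_ifs with hxy
      · simp
      · rw [linkHom_tau _ _ h, if_neg, MonoidHom.one_apply]
        simp only [Prod.mk.injEq]
        grind
    exact congrArg Multiplicative.toAdd (DFunLike.congr_fun this σ)
  · have : ((linkHom a b).comp (incl {i}ᶜ)).comp (d i) = linkHom a b := hom_ext fun x y h => by
      rw [MonoidHom.comp_apply, MonoidHom.comp_apply, e x y h]
      split_ifs with hxy
      · rw [linkHom_tau _ _ h, if_neg, map_one]
        simp only [Prod.mk.injEq]
        grind
      · rfl
    exact congrArg Multiplicative.toAdd (DFunLike.congr_fun this σ)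

theorem theta_mul_kerPart {ι : Type} [LinearOrder ι] (i : ι) (σ : HGroup ι) :
    theta i σ * (kerPart i σ : HGroup ι) = σ := by
  simp [kerPart]

theorem lk_kerPart {ι : Type} [LinearOrder ι] (i : ι) (σ : HGroup ι) (a b : ι) :
    lk (kerPart i σ : HGroup ι) a b = if a = i ∨ b = i then lk σ a b else 0 := by
  have h : lk σ a b = lk (theta i σ) a b + lk (kerPart i σ : HGroup ι) a b := by
    rw [← lk_mul, theta_mul_kerPart]
  rw [lk_theta] at h
  split_ifs at h ⊢ <;> omega

theorem pconj_eq {ι : Type} [LinearOrder ι] (i j : ι) (σ : HGroup ι) :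
    pconj i j σ = theta i σ * (tau i j * kerPart i σ * (tau i j)⁻¹) := rfl

theorem lk_conj {ι : Type} [LinearOrder ι] (i j : ι) (σ : HGroup ι) : (conj i j σ).lk = σ.lk := by
  funext a b
  simp only [conj, lk_mul, lk_inv]
  ring

theorem lk_pconj {ι : Type} [LinearOrder ι] (i j : ι) (σ : HGroup ι) :
    (pconj i j σ).lk = σ.lk := by
  funext a b
  conv_rhs => rw [← theta_mul_kerPart i σ]
  simp only [pconj_eq, lk_mul, lk_inv]
  ring

/-! ### Realizing prescribed linking numbers and triple linking numbers. -/

theorem lk_list_prod {ι : Type} [LinearOrder ι] (L : List (HGroup ι)) (a b : ι) :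
    lk L.prod a b = (L.map fun σ => lk σ a b).sum := by
  induction L with
  | nil => simp [lk_one]
  | cons σ L ih => simp [lk_mul, ih]

theorem exists_lk_eq {k : ℕ} {l : Fin k → Fin k → ℤ} (hl : ∀ i j, l i j = l j i)
    (hl0 : ∀ i, l i i = 0) : ∃ σ : HGroup (Fin k), σ.lk = l := by
  let σ := ((Finset.univ : Finset (PureGen (Fin k))).toList.map
    fun p => (tau p.1.1 p.1.2 ^ l p.1.1 p.1.2 : HGroup (Fin k))).prod
  have h (a b : Fin k) (hab : a < b) : σ.lk a b = l a b := by
    rw [lk_list_prod, List.map_map, Finset.sum_map_toList, Finset.sum_eq_single ⟨(a, b), hab⟩]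
    · simp [lk_zpow, lk_tau hab.ne]
    · rintro ⟨⟨i, j⟩, hij⟩ - hne
      dsimp only at hij
      rw [Function.comp_apply, lk_zpow, lk_tau hij.ne, if_neg, mul_zero]
      rintro (⟨rfl, rfl⟩ | ⟨rfl, rfl⟩)
      · exact hne rfl
      · exact absurd hij hab.not_gt
    · exact fun h => absurd (Finset.mem_univ _) h
  refine ⟨σ, ?_⟩
  funext a b
  rcases lt_trichotomy a b with hab | rfl | hab
  · exact h a b hab
  · rw [lk_self, hl0]
  · rw [lk_comm, h b a hab, hl]

end HGroup

theorem Triple.ext {k : ℕ} {p q : Triple k} (hr : p.r = q.r) (hs : p.s = q.s) (ht : p.t = q.t) :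
    p = q := by
  cases p
  cases q
  simp_all

noncomputable instance (k : ℕ) : Fintype (Triple k) :=
  Fintype.ofInjective (fun p => (p.r, p.s, p.t)) fun _ _ h =>
    Triple.ext (congrArg (·.1) h) (congrArg (·.2.1) h) (congrArg (·.2.2) h)

namespace HGroup

theorem milnorHom_triple {k : ℕ} (p : Triple k) (σ : HGroup (Fin k)) :
    milnorHom p.hrs p.hst σ = ⟨lk σ p.r p.s, lk σ p.r p.t, lk σ p.s p.t, muVec σ p⟩ :=
  milnorHom_eq p.hrs p.hst σ

theorem muVec_eq {k : ℕ} (σ : HGroup (Fin k)) (p : Triple k) :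
    muVec σ p = (milnorHom p.hrs p.hst σ).d :=
  mu_eq p.hrs p.hst σ

/-- The cocycle vanishes when the right factor has no linking. -/
theorem muVec_mul_of_lk_eq_zero {k : ℕ} (σ κ : HGroup (Fin k)) (h : κ.lk = 0) :
    muVec (σ * κ) = muVec σ + muVec κ := by
  funext p
  rw [Pi.add_apply, muVec_eq, map_mul, milnorHom_triple, milnorHom_triple, h]
  simp [Heis.cocycle]

theorem muVec_list_prod {k : ℕ} (L : List (HGroup (Fin k))) (hL : ∀ κ ∈ L, κ.lk = 0) :
    L.prod.lk = 0 ∧ muVec L.prod = (L.map muVec).sum := by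
  induction L with
  | nil =>
    refine ⟨by funext a b; simp [lk_one], funext fun p => ?_⟩
    simp [muVec_eq]
  | cons κ L ih =>
    obtain ⟨h1, h2⟩ := ih fun τ hτ => hL τ (List.mem_cons_of_mem _ hτ)
    have hκ := hL κ List.mem_cons_self
    refine ⟨?_, ?_⟩
    · funext a b
      rw [List.prod_cons, lk_mul, hκ, h1]
      rfl
    · rw [List.prod_cons, muVec_mul_of_lk_eq_zero _ _ h1, h2, List.map_cons, List.sum_cons]

theorem lk_commutator_zpow {ι : Type} [LinearOrder ι] (σ τ : HGroup ι) (n : ℤ) :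
    (⁅σ, τ⁆ ^ n).lk = 0 := by
  funext a b
  simp only [lk_zpow, commutatorElement_def, lk_mul, lk_inv, Pi.zero_apply]
  ring

/-- A triple other than $p$ misses one of the pairs $rt$, $st$, so one entry of the commutator maps
to $1$. -/
theorem muVec_commutator_zpow {k : ℕ} [DecidableEq (Triple k)] (p q : Triple k) (n : ℤ) :
    muVec (⁅tau p.r p.t, tau p.s p.t⁆ ^ n : HGroup (Fin k)) q = if p = q then n else 0 := by
  obtain ⟨r, s, t, hrs, hst⟩ := p
  obtain ⟨r', s', t', hrs', hst'⟩ := q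
  have hrt := hrs.trans hst
  simp only [muVec_eq, map_zpow, map_commutatorElement, Heis.commutator_eq, Heis.zpow_w,
    milnorHom_tau hrs' hst' hrt, milnorHom_tau hrs' hst' hst, milnorGen, Heis.form, Heis.cocycle,
    Prod.mk.injEq, Triple.mk.injEq]
  grind

theorem exists_lk_muVec_eq {k : ℕ} {l : Fin k → Fin k → ℤ} (hl : ∀ i j, l i j = l j i)
    (hl0 : ∀ i, l i i = 0) (v : MuLattice k) :
    ∃ σ : HGroup (Fin k), σ.lk = l ∧ muVec σ = v := by
  classical
  obtain ⟨σ, hσ⟩ := exists_lk_eq hl hl0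
  -- The exponents are the defect between the wanted vector and the $\mu$-vector of an arbitrary
  -- $\sigma$ with the right linking numbers.
  let L := (Finset.univ : Finset (Triple k)).toList.map fun p =>
    (⁅tau p.r p.t, tau p.s p.t⁆ ^ (v p - muVec σ p) : HGroup (Fin k))
  obtain ⟨h1, h2⟩ := muVec_list_prod L (by
    intro κ hκ
    obtain ⟨p, -, rfl⟩ := List.mem_map.1 hκ
    exact lk_commutator_zpow _ _ _)
  refine ⟨σ * L.prod, ?_, ?_⟩
  · funext a b
    rw [lk_mul, h1, hσ]
    exact add_zero _
  · rw [muVec_mul_of_lk_eq_zero _ _ h1, h2, List.map_map, Finset.sum_map_toList]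
    funext q
    simp [muVec_commutator_zpow]

/-! ### Translation vectors. -/

/-- The vector of the pairings of `m` with `l` on all the triples: the change of `μ` under the
commutator with a string link that has the linking numbers `m`. -/
def commVec {k : ℕ} (m l : Fin k → Fin k → ℤ) : MuLattice k := fun p =>
  Heis.form (m p.r p.s) (m p.r p.t) (m p.s p.t) (l p.r p.s) (l p.r p.t) (l p.s p.t)

/-- The change of $\mu$ is central in `Heis`, so the factor $\theta$ does not affect it. Conjugation
is the case $\theta=1$; partial conjugation takes $\theta$ and $g$ from the decomposition of
$\sigma$. -/
theorem muVec_mul_conj {k : ℕ} (θ h g : HGroup (Fin k)) :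
    muVec (θ * (h * g * h⁻¹)) = muVec (θ * g) + commVec h.lk g.lk := by
  funext p
  rw [Pi.add_apply, muVec_eq, muVec_eq, map_mul, map_mul, map_mul, map_inv, map_mul, Heis.conj_eq]
  simp only [milnorHom_triple, commVec, Heis.mul_d]
  ring

theorem inducesTranslation_conj {k : ℕ} (l : Fin k → Fin k → ℤ) (i j : Fin k) :
    InducesTranslation l (conj i j) (commVec (tau i j).lk l) := by
  rintro σ rfl
  refine ⟨lk_conj i j σ, ?_⟩
  simpa [conj] using muVec_mul_conj 1 (tau i j) σ

theorem inducesTranslation_pconj {k : ℕ} (l : Fin k → Fin k → ℤ) (i j : Fin k) :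
    InducesTranslation l (pconj i j)
      (commVec (tau i j).lk fun a b => if a = i ∨ b = i then l a b else 0) := by
  rintro σ rfl
  refine ⟨lk_pconj i j σ, ?_⟩
  rw [pconj_eq, muVec_mul_conj, theta_mul_kerPart]
  congr 2
  funext a b
  exact lk_kerPart i σ a b

theorem eq_of_inducesTranslation {k : ℕ} {l : Fin k → Fin k → ℤ} (hl : ∀ i j, l i j = l j i)
    (hl0 : ∀ i, l i i = 0) {F : HGroup (Fin k) → HGroup (Fin k)} {T T' : MuLattice k}
    (h : InducesTranslation l F T) (h' : InducesTranslation l F T') : T = T' := by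
  obtain ⟨σ, hσ⟩ := exists_lk_eq hl hl0
  exact add_left_cancel ((h σ hσ).2.symm.trans (h' σ hσ).2)

/-! ### Relations between the translation vectors. -/

theorem sum_erase_eq_of_triple {k : ℕ} (i : Fin k) (p : Triple k) (f : Fin k → ℤ)
    (hf : ∀ j, j ≠ i → j ≠ p.r → j ≠ p.s → j ≠ p.t → f j = 0) :
    ∑ j ∈ Finset.univ.erase i, f j =
      (if p.r = i then 0 else f p.r) + (if p.s = i then 0 else f p.s) +
        (if p.t = i then 0 else f p.t) := by
  have h1 := p.hrs.ne
  have h2 := p.hst.ne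
  have h3 := (p.hrs.trans p.hst).ne
  have e : ∑ j ∈ Finset.univ.erase i, f j = ∑ j, if j = i then 0 else f j := by
    rw [← Finset.sum_erase (f := fun j => if j = i then 0 else f j) _ (if_pos (Eq.refl i))]
    exact Finset.sum_congr rfl fun j hj => (if_neg (Finset.ne_of_mem_erase hj)).symm
  rw [e, ← Finset.sum_subset (Finset.subset_univ {p.r, p.s, p.t})]
  · rw [Finset.sum_insert (by simp [h1, h3]), Finset.sum_insert (by simp [h2]),
      Finset.sum_singleton, add_assoc]
  · intro j _ hj
    simp only [Finset.mem_insert, Finset.mem_singleton, not_or] at hj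
    split_ifs with hji
    · rfl
    · exact hf j hji hj.1 hj.2.1 hj.2.2

/-- On a triple $\{i,j,m\}$ this is $\varepsilon(i,j,m)(l_{im}-l_{jm})$, evaluated at increasing
pairs only; $l_{ij}$ drops out because the form is alternating. -/
theorem commVec_tau {k : ℕ} {i j : Fin k} (hij : i ≠ j) (l : Fin k → Fin k → ℤ) (p : Triple k) :
    commVec (tau i j).lk l p =
      (if (i = p.r ∧ j = p.s) ∨ (i = p.s ∧ j = p.r) then l p.r p.t - l p.s p.t
      else if (i = p.r ∧ j = p.t) ∨ (i = p.t ∧ j = p.r) then l p.s p.t - l p.r p.s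
      else if (i = p.s ∧ j = p.t) ∨ (i = p.t ∧ j = p.s) then l p.r p.s - l p.r p.t else 0) := by
  have h1 := p.hrs.ne
  have h2 := p.hst.ne
  have h3 := (p.hrs.trans p.hst).ne
  simp only [commVec, Heis.form, Heis.cocycle, lk_tau hij]
  grind

theorem commVec_tau_eq_add {k : ℕ} (l : Fin k → Fin k → ℤ) {i j : Fin k} (hij : i ≠ j) :
    commVec (tau i j).lk l =
      commVec (tau i j).lk (fun a b => if a = i ∨ b = i then l a b else 0) +
        commVec (tau j i).lk (fun a b => if a = j ∨ b = j then l a b else 0) := by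
  funext p
  have h1 := p.hrs.ne
  have h2 := p.hst.ne
  have h3 := (p.hrs.trans p.hst).ne
  simp only [Pi.add_apply, commVec_tau hij, commVec_tau hij.symm]
  grind

/-- On a triple $\{i,a,b\}$ only $j=a,b$ contribute, with the same $l_{ab}$ and opposite signs. -/
theorem sum_commVec_tau_swap {k : ℕ} (l : Fin k → Fin k → ℤ) (i : Fin k) :
    ∑ j ∈ Finset.univ.erase i,
      commVec (tau j i).lk (fun a b => if a = j ∨ b = j then l a b else 0) = 0 := by
  funext p
  have h1 := p.hrs.ne
  have h2 := p.hst.ne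
  have h3 := (p.hrs.trans p.hst).ne
  rw [Finset.sum_apply, Finset.sum_congr rfl fun j hj =>
    commVec_tau (Finset.ne_of_mem_erase hj) _ p, sum_erase_eq_of_triple i p _ (by grind),
    Pi.zero_apply]
  grind

/-- On a triple $\{i,a,b\}$ the terms $j=a,b$ are $\pm l_{ia}l_{ib}$ with opposite signs. Symmetry
of $l$ matches the coefficients $l_{ij}$ with the increasing pairs in `commVec`. -/
theorem sum_smul_commVec_tau {k : ℕ} {l : Fin k → Fin k → ℤ} (hl : ∀ i j, l i j = l j i)
    (i : Fin k) :
    ∑ j ∈ Finset.univ.erase i, l i j •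
      commVec (tau i j).lk (fun a b => if a = i ∨ b = i then l a b else 0) = 0 := by
  funext p
  have h1 := p.hrs.ne
  have h2 := p.hst.ne
  have h3 := (p.hrs.trans p.hst).ne
  rw [Finset.sum_apply, Finset.sum_congr rfl fun j hj => by
    rw [Pi.smul_apply, commVec_tau (Finset.ne_of_mem_erase hj).symm _ p, smul_eq_mul],
    sum_erase_eq_of_triple i p _ (by grind), Pi.zero_apply]
  have e1 := hl p.r p.s
  have e2 := hl p.r p.t
  have e3 := hl p.s p.t
  grind

end HGroup

theorem mainTheorem4 (k : ℕ) :
    -- normal forms exist and are unique, with exponents the linking numbers and `μ(rst)`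
    (∀ (σ : HGroup (Fin k)) (p : Triple k) (α β γ δ : ℤ),
      σ.IsNormalForm p.r p.s p.t α β γ δ ↔
        α = σ.lk p.r p.s ∧ β = σ.lk p.r p.t ∧ γ = σ.lk p.s p.t ∧ δ = muVec σ p) ∧
    ∀ l : Fin k → Fin k → ℤ, (∀ i j, l i j = l j i) → (∀ i, l i i = 0) →
      -- every vector of the lattice is the `μ`-vector of a string link with linking numbers `l`
      (∀ v : MuLattice k, ∃ σ : HGroup (Fin k), σ.lk = l ∧ muVec σ = v) ∧
      -- conjugations and partial conjugations induce unique translations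
      (∀ i j : Fin k, i ≠ j → ∃! T : MuLattice k, InducesTranslation l (HGroup.conj i j) T) ∧
      (∀ i j : Fin k, i ≠ j → ∃! T : MuLattice k, InducesTranslation l (HGroup.pconj i j) T) ∧
      -- the relations between the translation vectors
      ∀ C P : Fin k → Fin k → MuLattice k,
        (∀ i j, i ≠ j → InducesTranslation l (HGroup.conj i j) (C i j)) →
        (∀ i j, i ≠ j → InducesTranslation l (HGroup.pconj i j) (P i j)) →
          (∀ i j, i ≠ j → C i j = P i j + P j i) ∧
          (∀ i, ∑ j ∈ Finset.univ.erase i, P j i = 0) ∧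
          (∀ i, ∑ j ∈ Finset.univ.erase i, l i j • P i j = 0) := by
  refine ⟨fun σ p α β γ δ => ?_, fun l hl hl0 => ⟨HGroup.exists_lk_muVec_eq hl hl0, fun i j _ => ?_,
    fun i j _ => ?_, fun C P hC hP => ?_⟩⟩
  · rw [HGroup.isNormalForm_iff p.hrs p.hst, HGroup.milnorHom_triple, Heis.mk.injEq]
    simp only [eq_comm]
  · exact ⟨_, HGroup.inducesTranslation_conj l i j, fun T hT =>
      HGroup.eq_of_inducesTranslation hl hl0 hT (HGroup.inducesTranslation_conj l i j)⟩
  · exact ⟨_, HGroup.inducesTranslation_pconj l i j, fun T hT =>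
      HGroup.eq_of_inducesTranslation hl hl0 hT (HGroup.inducesTranslation_pconj l i j)⟩
  · have eC (i j : Fin k) (hij : i ≠ j) := HGroup.eq_of_inducesTranslation hl hl0 (hC i j hij)
      (HGroup.inducesTranslation_conj l i j)
    have eP (i j : Fin k) (hij : i ≠ j) := HGroup.eq_of_inducesTranslation hl hl0 (hP i j hij)
      (HGroup.inducesTranslation_pconj l i j)
    refine ⟨fun i j hij => ?_, fun i => ?_, fun i => ?_⟩
    · rw [eC i j hij, eP i j hij, eP j i hij.symm, HGroup.commVec_tau_eq_add l hij]
    · rw [← HGroup.sum_commVec_tau_swap l i]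
      exact Finset.sum_congr rfl fun j hj => eP j i (Finset.ne_of_mem_erase hj)
    · rw [← HGroup.sum_smul_commVec_tau hl i]
      exact Finset.sum_congr rfl fun j hj => by rw [eP i j (Finset.ne_of_mem_erase hj).symm]
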